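/- Let $K$ be a field of characteristic $2$ and let $R = K[U,V,W]$ be the standard graded polynomial ring. For every $n \ge 1$, let $\mathcal{B}_n$ be the set of all monomials in $U,V,W$ which are coefficients of $(UX+VY+WZ)^n \in R[X,Y,Z]$, and let $I_n$ be the ideal of $R$ generated by $\mathcal{B}_n$. If $2^l \le n \le 2^{l+1}-1$ for some integer $l \ge 0$, then $$\operatorname{reg}(R/I_n) = 3(2^l-1),$$ where $\operatorname{reg}(M) = \sup_{i \ge 0}\{\operatorname{end}(\operatorname{Tor}_i^R(M,K)) - i\}$ denotes the Castelnuovo–Mumford regularity of a graded $R$-module $M$, $K = R/(U,V,W)$, and $\operatorname{end}(T) = \sup\{j \in \mathbb{Z} : T_j \ne 0\}$. -/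

import Mathlib

open MvPolynomial

noncomputable section

/-! ### Graded free resolutions of the residue field, graded Tor, regularity

Throughout, `MvPolynomial σ K` is the standard graded polynomial ring over the field `K`
(every variable has degree `1`), and degrees are integers. The component of degree `j : ℤ` is
`weightedHomogeneousSubmodule K (fun _ => 1) j`, which is zero when `j < 0`. -/

/-- A graded free resolution `⋯ → P₂ → P₁ → P₀ → K → 0` of the residue field
`K = MvPolynomial σ K ⧸ (variables)` over `S = MvPolynomial σ K`, by graded free modules of finite
rank `P i = ⨁_{b : ι i} S(-deg i b)`, with degree-zero maps. -/
structure GradedFreeResolution (σ K : Type*) [Field K] where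
  /-- the index set of a homogeneous basis of `P i` -/
  ι : ℕ → Type
  [fintype : ∀ i, Fintype (ι i)]
  /-- the degrees of the basis elements -/
  deg : ∀ i, ι i → ℤ
  /-- the matrix of the differential `P (i + 1) → P i` -/
  d : ∀ i, Matrix (ι i) (ι (i + 1)) (MvPolynomial σ K)
  /-- the images in `K` of the basis elements of `P 0` under the augmentation `P 0 → K` -/
  aug : ι 0 → K
  /-- the differentials have degree zero -/
  d_homogeneous : ∀ i a b,
    IsWeightedHomogeneous (fun _ : σ => (1 : ℤ)) (d i a b) (deg (i + 1) b - deg i a)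
  /-- the augmentation has degree zero (`K` is concentrated in degree `0`) -/
  aug_homogeneous : ∀ a, aug a ≠ 0 → deg 0 a = 0
  /-- the augmentation is onto `K` -/
  aug_surjective : Function.Surjective
    fun x : ι 0 → MvPolynomial σ K => ∑ a, constantCoeff (x a) * aug a
  /-- exactness at `P 0` -/
  exact_zero : ∀ x : ι 0 → MvPolynomial σ K,
    ∑ a, constantCoeff (x a) * aug a = 0 ↔ ∃ y, (d 0).mulVec y = x
  /-- exactness at `P (i + 1)` -/
  exact_succ : ∀ i, ∀ x : ι (i + 1) → MvPolynomial σ K,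
    (d i).mulVec x = 0 ↔ ∃ y, (d (i + 1)).mulVec y = x

attribute [instance] GradedFreeResolution.fintype

namespace GradedFreeResolution

variable {σ K : Type*} [Field K] (P : GradedFreeResolution σ K)
  (M : Type*) [AddCommGroup M] [Module K M] [Module (MvPolynomial σ K) M]
  [IsScalarTower K (MvPolynomial σ K) M]

/-- The differential `P (i + 1) ⊗ M → P i ⊗ M`, where `P i ⊗ M` is written as `ι i → M`. -/
def tensorD (i : ℕ) : (P.ι (i + 1) → M) →ₗ[K] (P.ι i → M) :=
  LinearMap.restrictScalars K (LinearMap.pi fun a =>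
    ∑ b, P.d i a b • (LinearMap.proj b : (P.ι (i + 1) → M) →ₗ[MvPolynomial σ K] M))

/-- The cycles of the complex `P ⊗ M` in homological degree `i`. -/
def cycles : ∀ i : ℕ, Submodule K (P.ι i → M)
  | 0 => ⊤
  | i + 1 => LinearMap.ker (P.tensorD M i)

variable {M} (𝓜 : ℤ → Submodule K M)

/-- The component of internal degree `j` of `P i ⊗ M = ⨁_{b : ι i} M(-deg i b)`, for a graded
module `M` with homogeneous components `𝓜`. -/
def tensorPiece (i : ℕ) (j : ℤ) : Submodule K (P.ι i → M) :=
  Submodule.pi Set.univ fun b => 𝓜 (j - P.deg i b)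

/-- The homogeneous cycles of homological degree `i` and internal degree `j`. -/
def homogeneousCycles (i : ℕ) (j : ℤ) : Submodule K (P.ι i → M) :=
  P.cycles M i ⊓ P.tensorPiece 𝓜 i j

/-- The homogeneous boundaries of homological degree `i` and internal degree `j`. -/
def homogeneousBoundaries (i : ℕ) (j : ℤ) : Submodule K (P.ι i → M) :=
  (P.tensorPiece 𝓜 (i + 1) j).map (P.tensorD M i)

/-- `Tor_i^S(M, K)_j`, the component of internal degree `j` of `Tor_i^S(M, K)`, computed from the
graded free resolution `P` of `K`: the homology of `P ⊗ M`. -/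
abbrev gradedTor (i : ℕ) (j : ℤ) : Type _ :=
  ↥(P.homogeneousCycles 𝓜 i j) ⧸
    (P.homogeneousBoundaries 𝓜 i j).submoduleOf (P.homogeneousCycles 𝓜 i j)

end GradedFreeResolution

/-- `end(T) = sup {j ∈ ℤ | T_j ≠ 0}` for a graded object `T`, with value `-∞` when `T = 0`. -/
def gradedEnd (T : ℤ → Type*) : EReal :=
  ⨆ (j : ℤ) (_ : Nontrivial (T j)), ((j : ℝ) : EReal)

/-! ### The Koszul resolution of `K` over a polynomial ring in three variables -/

namespace Koszul

/-- The ranks `1, 3, 3, 1, 0, 0, …` of the free modules in the Koszul resolution. -/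
def rank : ℕ → ℕ
  | 0 => 1
  | 1 => 3
  | 2 => 3
  | 3 => 1
  | _ + 4 => 0

variable (K : Type*) [Field K]

/-- The differentials of the Koszul resolution, in the bases `1`; `e₀, e₁, e₂`;
`e₀e₁, e₀e₂, e₁e₂`; `e₀e₁e₂`. -/
def d : ∀ i, Matrix (Fin (rank i)) (Fin (rank (i + 1))) (MvPolynomial (Fin 3) K)
  | 0 => (!![X 0, X 1, X 2] : Matrix (Fin 1) (Fin 3) _)
  | 1 => (!![-X 1, -X 2, 0; X 0, 0, -X 2; 0, X 0, X 1] : Matrix (Fin 3) (Fin 3) _)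
  | 2 => (!![X 2; -X 1; X 0] : Matrix (Fin 3) (Fin 1) _)
  | _ + 3 => 0

variable {K}

theorem mem_span_of_X_mul_mem {s : Set (Fin 3)} {k : Fin 3} (hk : k ∉ s)
    {c : MvPolynomial (Fin 3) K} (h : X k * c ∈ Ideal.span (X '' s)) :
    c ∈ Ideal.span ((X : Fin 3 → MvPolynomial (Fin 3) K) '' s) := by
  rw [mem_ideal_span_X_image] at h ⊢
  intro m hm
  obtain ⟨i, hi, hmi⟩ := h (Finsupp.single k 1 + m) (by
    rw [mem_support_iff, coeff_X_mul]; exact mem_support_iff.mp hm)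
  refine ⟨i, hi, ?_⟩
  have : k ≠ i := fun e => hk (e ▸ hi)
  simpa [Finsupp.single_apply, this] using hmi

theorem dvd_of_mul_eq {i k : Fin 3} (hk : k ≠ i) {c e : MvPolynomial (Fin 3) K}
    (h : X k * c = X i * e) : ∃ t, c = X i * t := by
  have := mem_span_of_X_mul_mem (K := K) (s := {i}) (k := k) (by simpa using hk) (c := c) (by
    rw [h, Set.image_singleton]; exact Ideal.mem_span_singleton.mpr ⟨e, rfl⟩)
  rw [Set.image_singleton] at this
  exact Ideal.mem_span_singleton.mp this

theorem exact_at_zero (x : MvPolynomial (Fin 3) K) :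
    constantCoeff x = 0 ↔ ∃ y : Fin 3 → MvPolynomial (Fin 3) K,
      X 0 * y 0 + X 1 * y 1 + X 2 * y 2 = x := by
  constructor
  · intro h
    have hx : x ∈ Ideal.span ((X : Fin 3 → MvPolynomial (Fin 3) K) '' Set.univ) := by
      rw [mem_ideal_span_X_image]
      intro m hm
      by_contra! hc
      have hm0 : m = 0 := Finsupp.ext fun i => hc i (Set.mem_univ i)
      rw [hm0, mem_support_iff] at hm
      exact hm h
    rw [Set.image_univ, Ideal.mem_span_range_iff_exists_fun] at hx
    obtain ⟨c, hc⟩ := hx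
    refine ⟨c, ?_⟩
    rw [← hc, Fin.sum_univ_three]
    ring
  · rintro ⟨y, rfl⟩
    simp

theorem exact_at_one (x : Fin 3 → MvPolynomial (Fin 3) K) :
    X 0 * x 0 + X 1 * x 1 + X 2 * x 2 = 0 ↔ ∃ y : Fin 3 → MvPolynomial (Fin 3) K,
      -X 1 * y 0 - X 2 * y 1 = x 0 ∧ X 0 * y 0 - X 2 * y 2 = x 1 ∧
        X 0 * y 1 + X 1 * y 2 = x 2 := by
  constructor
  · intro h
    have h2 : x 2 ∈ Ideal.span ((X : Fin 3 → MvPolynomial (Fin 3) K) '' {0, 1}) := by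
      apply mem_span_of_X_mul_mem (k := 2) (by decide)
      rw [Set.image_pair, Ideal.mem_span_pair]
      exact ⟨-x 0, -x 1, by linear_combination -h⟩
    rw [Set.image_pair, Ideal.mem_span_pair] at h2
    obtain ⟨p, q, hpq⟩ := h2
    have h1 : X 1 * (x 1 + X 2 * q) = X 0 * (-(x 0 + X 2 * p)) := by
      linear_combination h + X 2 * hpq
    obtain ⟨r, hr⟩ := dvd_of_mul_eq (by decide) h1
    have h0 : -(x 0 + X 2 * p) = X 1 * r := by
      apply mul_left_cancel₀ (X_ne_zero (R := K) (0 : Fin 3))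
      rw [← h1, hr]
      ring
    refine ⟨![r, p, q], ?_, ?_, ?_⟩ <;> simp
    · linear_combination h0
    · linear_combination -hr
    · linear_combination hpq
  · rintro ⟨y, h0, h1, h2⟩
    rw [← h0, ← h1, ← h2]
    ring

theorem exact_at_two (x : Fin 3 → MvPolynomial (Fin 3) K) :
    (-X 1 * x 0 - X 2 * x 1 = 0 ∧ X 0 * x 0 - X 2 * x 2 = 0 ∧ X 0 * x 1 + X 1 * x 2 = 0) ↔
      ∃ y : MvPolynomial (Fin 3) K, X 2 * y = x 0 ∧ -X 1 * y = x 1 ∧ X 0 * y = x 2 := by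
  constructor
  · rintro ⟨h0, h1, -⟩
    obtain ⟨t, ht⟩ := dvd_of_mul_eq (K := K) (k := 1) (i := 2) (c := x 0) (e := -x 1) (by decide)
      (by linear_combination -h0)
    rw [ht] at h0 h1
    refine ⟨t, ht.symm, ?_, ?_⟩ <;> apply mul_left_cancel₀ (X_ne_zero (R := K) (2 : Fin 3))
    · linear_combination h0
    · linear_combination h1
  · rintro ⟨y, h0, h1, h2⟩
    rw [← h0, ← h1, ← h2]
    refine ⟨?_, ?_, ?_⟩ <;> ring

/-- The Koszul resolution of `K` over `MvPolynomial (Fin 3) K`. -/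
def resolution (K : Type*) [Field K] : GradedFreeResolution (Fin 3) K where
  ι i := Fin (rank i)
  deg i _ := i
  d := d K
  aug _ := 1
  d_homogeneous := by
    have hX : ∀ k : Fin 3, IsWeightedHomogeneous (fun _ : Fin 3 => (1 : ℤ))
        (X k : MvPolynomial (Fin 3) K) 1 := fun k => isWeightedHomogeneous_X K _ k
    have hN : ∀ k : Fin 3, IsWeightedHomogeneous (fun _ : Fin 3 => (1 : ℤ))
        (-X k : MvPolynomial (Fin 3) K) 1 := fun k =>
      (weightedHomogeneousSubmodule K (fun _ : Fin 3 => (1 : ℤ)) 1).neg_mem (hX k)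
    have h0 : IsWeightedHomogeneous (fun _ : Fin 3 => (1 : ℤ))
        (0 : MvPolynomial (Fin 3) K) 1 := isWeightedHomogeneous_zero K _ 1
    intro i a b
    have e : ((i + 1 : ℕ) : ℤ) - (i : ℕ) = 1 := by push_cast; ring
    rw [e]
    match i, a, b with
    | 0, a, b => change Fin 1 at a; change Fin 3 at b; fin_cases a; fin_cases b <;> simp [d, hX]
    | 1, a, b =>
      change Fin 3 at a; change Fin 3 at b
      fin_cases a <;> fin_cases b <;> simp [d, hX, hN, h0]
    | 2, a, b =>
      change Fin 3 at a; change Fin 1 at b; fin_cases b; fin_cases a <;> simp [d, hX, hN]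
    | i + 3, a, b => exact h0
  aug_homogeneous _ _ := rfl
  aug_surjective := fun c => ⟨fun _ => C c, by
    change ∑ _a : Fin 1, _ = _
    simp⟩
  exact_zero := by
    intro x
    change Fin 1 → _ at x
    change ∑ a : Fin 1, constantCoeff (x a) * (1 : K) = 0 ↔
      ∃ y : Fin 3 → MvPolynomial (Fin 3) K,
        (!![X 0, X 1, X 2] : Matrix (Fin 1) (Fin 3) _).mulVec y = x
    simp only [Fin.sum_univ_one, mul_one, exact_at_zero, funext_iff, Fin.forall_fin_one,
      Matrix.mulVec, dotProduct, Fin.sum_univ_three]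
    simp
  exact_succ := by
    intro i x
    match i, x with
    | 0, x =>
      change Fin 3 → _ at x
      change (!![X 0, X 1, X 2] : Matrix (Fin 1) (Fin 3) _).mulVec x = 0 ↔
        ∃ y : Fin 3 → MvPolynomial (Fin 3) K,
          (!![-X 1, -X 2, 0; X 0, 0, -X 2; 0, X 0, X 1] : Matrix (Fin 3) (Fin 3) _).mulVec y = x
      have := exact_at_one x
      simp only [funext_iff, Fin.forall_fin_succ, Matrix.mulVec, dotProduct,
        Fin.sum_univ_three]
      simpa [sub_eq_add_neg] using this
    | 1, x =>
      change Fin 3 → _ at x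
      change (!![-X 1, -X 2, 0; X 0, 0, -X 2; 0, X 0, X 1] :
          Matrix (Fin 3) (Fin 3) _).mulVec x = 0 ↔
        ∃ y : Fin 1 → MvPolynomial (Fin 3) K,
          (!![X 2; -X 1; X 0] : Matrix (Fin 3) (Fin 1) _).mulVec y = x
      have h := exact_at_two x
      have e : (∃ y : Fin 1 → MvPolynomial (Fin 3) K,
          X 2 * y 0 = x 0 ∧ -X 1 * y 0 = x 1 ∧ X 0 * y 0 = x 2) ↔
          ∃ y : MvPolynomial (Fin 3) K, X 2 * y = x 0 ∧ -X 1 * y = x 1 ∧ X 0 * y = x 2 :=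
        ⟨fun ⟨y, hy⟩ => ⟨y 0, hy⟩, fun ⟨y, hy⟩ => ⟨fun _ => y, hy⟩⟩
      rw [← e] at h
      simp only [funext_iff, Fin.forall_fin_succ, Matrix.mulVec, dotProduct,
        Fin.sum_univ_three, Fin.sum_univ_one]
      simpa [sub_eq_add_neg] using h
    | 2, x =>
      change Fin 1 → _ at x
      change (!![X 2; -X 1; X 0] : Matrix (Fin 3) (Fin 1) _).mulVec x = 0 ↔
        ∃ y : Fin 0 → MvPolynomial (Fin 3) K,
          (0 : Matrix (Fin 1) (Fin 0) (MvPolynomial (Fin 3) K)).mulVec y = x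
      constructor
      · intro h
        have h0 := congrFun h 0
        simp [Matrix.mulVec, dotProduct] at h0
        refine ⟨0, ?_⟩
        ext1 a
        fin_cases a
        simp [h0]
      · rintro ⟨y, rfl⟩
        simp
    | i + 3, x =>
      change Fin 0 → _ at x
      exact ⟨fun _ => ⟨0, funext fun a => a.elim0⟩, fun _ => by
        rw [Subsingleton.elim x 0]; exact Matrix.mulVec_zero _⟩

end Koszul

/-! ### Castelnuovo–Mumford regularity over `K[U, V, W]` -/

/-- The Castelnuovo–Mumford regularity `reg M = sup_i {end (Tor_i^R(M, K)) - i}` of a graded module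
`M`, with homogeneous components `𝓜`, over the standard graded ring
`R = K[U, V, W] = MvPolynomial (Fin 3) K`. -/
def regularity {K M : Type*} [Field K] [AddCommGroup M] [Module K M]
    [Module (MvPolynomial (Fin 3) K) M] [IsScalarTower K (MvPolynomial (Fin 3) K) M]
    (𝓜 : ℤ → Submodule K M) : EReal :=
  ⨆ i : ℕ, gradedEnd ((Koszul.resolution K).gradedTor 𝓜 i) - (i : EReal)

/-- The grading of `R ⧸ I`, for a homogeneous ideal `I` of the standard graded polynomial ring `R`:
the component of degree `j` is the image of the component of degree `j` of `R`. -/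
def quotientGrading {σ K : Type*} [Field K] (I : Ideal (MvPolynomial σ K)) (j : ℤ) :
    Submodule K (MvPolynomial σ K ⧸ I) :=
  (weightedHomogeneousSubmodule K (fun _ : σ => (1 : ℤ)) j).map
    (Ideal.Quotient.mkₐ K I).toLinearMap

/-! ### The coefficient ideals -/

/-- The linear form `U X + V Y + W Z` in `R[X, Y, Z]`, where `R = K[U, V, W]`. -/
def genericForm (K : Type*) [Field K] : MvPolynomial (Fin 3) (MvPolynomial (Fin 3) K) :=
  ∑ i : Fin 3, C (X i) * X i

/-- The set of all monomials in `U, V, W` which are coefficients of `(U X + V Y + W Z) ^ n`. -/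
def coeffMonomials (K : Type*) [Field K] (n : ℕ) : Set (MvPolynomial (Fin 3) K) :=
  {f | (∃ s : Fin 3 →₀ ℕ, f = monomial s 1) ∧ ∃ a : Fin 3 →₀ ℕ, coeff a (genericForm K ^ n) = f}

/-- The ideal of `K[U, V, W]` generated by the monomials which are coefficients of
`(U X + V Y + W Z) ^ n`. -/
def coeffIdeal (K : Type*) [Field K] (n : ℕ) : Ideal (MvPolynomial (Fin 3) K) :=
  Ideal.span (coeffMonomials K n)

end

open MvPolynomial

/-! ### Coefficient monomials and Frobenius in characteristic 2 -/

section CoeffIdeal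

variable {K : Type*} [Field K]

/-! Put `q = 2 ^ l`, so `q ≤ n < 2 * q`. The quotient `R/I_n` vanishes in large degrees, and for
such a module the regularity is the top nonzero degree `D`. Indeed the Koszul complex computes
`Tor_i` in degree `j` as a subquotient of copies of the component of degree `j - i`, which bounds
the regularity by `D`; the component of degree `D` is killed by the variables, so it survives in
`Tor_3` in degree `D + 3` (`regularity_eq_of_top_degree`).

It remains to see that `D = 3 * (q - 1)`. With `F` the generic form, Frobenius gives `F ^ n = (U^q
X^q + V^q Y^q + W^q Z^q) * F ^ (n - q)`. Hence `I_n` lies in `(U^q, V^q, W^q)`, which misses `(UVW)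
^ (q - 1)`. Conversely, a monomial of degree at least `3 * q - 2` has some exponent at least `q`;
dividing by that `q`-th power and recursing on the binary digits of the exponent of `F` produces a
coefficient monomial dividing it (`exists_le_coeff_genericForm_pow_eq_monomial`). -/

theorem genericForm_pow_two_pow [CharP K 2] (l : ℕ) :
    genericForm K ^ 2 ^ l = ∑ i : Fin 3, C (X i ^ 2 ^ l) * X i ^ 2 ^ l := by
  rw [genericForm, sum_pow_char_pow]
  simp only [mul_pow, C_pow]

/-- Recursion that strips one power of two from the exponent of the form: by Frobenius that factor
has only three terms. -/
theorem coeff_genericForm_pow_two_pow_add [CharP K 2] (l m : ℕ) (a : Fin 3 →₀ ℕ) :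
    coeff a (genericForm K ^ (2 ^ l + m)) = ∑ i : Fin 3,
      X i ^ 2 ^ l * if 2 ^ l ≤ a i then
        coeff (a - Finsupp.single i (2 ^ l)) (genericForm K ^ m) else 0 := by
  rw [pow_add, genericForm_pow_two_pow, Finset.sum_mul, coeff_sum]
  refine Finset.sum_congr rfl fun i _ => ?_
  rw [mul_assoc, coeff_C_mul, X_pow_eq_monomial (n := i) (R := MvPolynomial (Fin 3) K),
    coeff_monomial_mul']
  simp only [Finsupp.single_le_iff, one_mul]

/-- The coefficients of `(U X + V Y + W Z) ^ n` lie in the Frobenius power `(U ^ q, V ^ q, W ^ q)`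
for `q = 2 ^ l ≤ n`. -/
theorem coeffIdeal_le_span_X_pow [CharP K 2] {n l : ℕ} (h : 2 ^ l ≤ n) :
    coeffIdeal K n ≤ Ideal.span
      ((fun s => monomial s (1 : K)) '' Set.range fun i : Fin 3 => Finsupp.single i (2 ^ l)) := by
  obtain ⟨m, rfl⟩ := Nat.exists_eq_add_of_le h
  refine Ideal.span_le.mpr ?_
  rintro _ ⟨-, a, rfl⟩
  rw [coeff_genericForm_pow_two_pow_add]
  refine Ideal.sum_mem _ fun i _ => Ideal.mul_mem_right _ _ (Ideal.subset_span ?_)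
  exact ⟨_, ⟨i, rfl⟩, X_pow_eq_monomial.symm⟩

/-- The monomial `(U V W) ^ (2 ^ l - 1)` is not in `coeffIdeal K n` for `2 ^ l ≤ n`. -/
theorem monomial_two_pow_sub_one_notMem_coeffIdeal [CharP K 2] {n l : ℕ} (h : 2 ^ l ≤ n) :
    monomial (Finsupp.equivFunOnFinite.symm fun _ : Fin 3 => 2 ^ l - 1) (1 : K) ∉
      coeffIdeal K n := by
  intro hm
  have := coeffIdeal_le_span_X_pow h hm
  rw [mem_ideal_span_monomial_image] at this
  obtain ⟨_, ⟨i, rfl⟩, hi⟩ := this (Finsupp.equivFunOnFinite.symm fun _ : Fin 3 => 2 ^ l - 1)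
    (by simp [mem_support_iff])
  have h1 := Finsupp.single_le_iff.mp hi
  have h2 : 0 < 2 ^ l := by positivity
  rw [Finsupp.equivFunOnFinite_symm_apply_apply] at h1
  omega

/-- Every monomial of degree at least `3 * 2 ^ l - 2` is divisible by a monomial which is a
coefficient of `(U X + V Y + W Z) ^ n`, when `n < 2 ^ (l + 1)`. -/
theorem exists_le_coeff_genericForm_pow_eq_monomial [CharP K 2] (l : ℕ) :
    ∀ n < 2 ^ (l + 1), ∀ s : Fin 3 →₀ ℕ, 3 * 2 ^ l ≤ s 0 + s 1 + s 2 + 2 →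
      ∃ a ≤ s, (∀ j, a j ≤ n) ∧ coeff a (genericForm K ^ n) = monomial a 1 := by
  -- the step which splits off the leading binary digit of the exponent
  have step : ∀ l m : ℕ, m < 2 ^ l → ∀ s : Fin 3 →₀ ℕ, ∀ i, 2 ^ l ≤ s i →
      (∃ a ≤ s - Finsupp.single i (2 ^ l), (∀ j, a j ≤ m) ∧
        coeff a (genericForm K ^ m) = monomial a 1) →
      ∃ a ≤ s, (∀ j, a j ≤ 2 ^ l + m) ∧
        coeff a (genericForm K ^ (2 ^ l + m)) = monomial a 1 := by
    rintro l m hm s i hi ⟨a, has, ham, hc⟩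
    refine ⟨a + Finsupp.single i (2 ^ l), ?_, fun j => ?_, ?_⟩
    · exact (le_tsub_iff_right (Finsupp.single_le_iff.mpr hi)).mp has
    · have h1 : Finsupp.single i (2 ^ l) j ≤ 2 ^ l := by
        rw [Finsupp.single_apply]; split_ifs <;> simp
      have h2 := ham j
      simp only [Finsupp.add_apply]
      omega
    · rw [coeff_genericForm_pow_two_pow_add, Finset.sum_eq_single i]
      · rw [if_pos (by simp), add_tsub_cancel_right, hc, X_pow_eq_monomial, monomial_mul, one_mul,
          add_comm]
      · intro j _ hj
        -- The bound carried through the induction pays off here: `a j ≤ m < 2 ^ l` for `j ≠ i`, so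
        -- only the `i`-th summand survives and nothing can cancel or be added to the monomial.
        rw [if_neg, mul_zero]
        have h2 := ham j
        rw [Finsupp.add_apply, Finsupp.single_eq_of_ne hj]
        omega
      · simp
  have zero : ∀ s : Fin 3 →₀ ℕ, ∃ a ≤ s, (∀ j, a j ≤ 0) ∧
      coeff a (genericForm K ^ 0) = monomial a 1 := fun s =>
    ⟨0, zero_le, fun _ => le_rfl, by rw [pow_zero, coeff_zero_one]; rfl⟩
  -- Pigeonhole: three exponents below `q` sum to at most `3 * q - 3`. Writing `+ 2` on the right
  -- avoids truncated subtraction.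
  have exists_le : ∀ (q : ℕ) (s : Fin 3 →₀ ℕ), 3 * q ≤ s 0 + s 1 + s 2 + 2 → ∃ i, q ≤ s i := by
    intro q s hs
    by_contra! hc
    have h0 := hc 0
    have h1 := hc 1
    have h2 := hc 2
    omega
  have sub_sum : ∀ (q : ℕ) (s : Fin 3 →₀ ℕ) (i : Fin 3), q ≤ s i →
      (s - Finsupp.single i q) 0 + (s - Finsupp.single i q) 1 + (s - Finsupp.single i q) 2 + q =
        s 0 + s 1 + s 2 := by
    intro q s i hi
    fin_cases i <;> simp at hi ⊢ <;> omega
  induction l with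
  | zero =>
    intro n hn s hs
    obtain rfl | rfl : n = 0 ∨ n = 2 ^ 0 + 0 := by simp at hn ⊢; omega
    · exact zero s
    · obtain ⟨i, hi⟩ := exists_le _ s hs
      exact step 0 0 (by simp) s i hi (zero _)
  | succ l ih =>
    intro n hn s hs
    have e1 : 2 ^ (l + 1) = 2 * 2 ^ l := by ring
    have e2 : 2 ^ (l + 1 + 1) = 4 * 2 ^ l := by ring
    have hpos : 0 < 2 ^ l := by positivity
    rcases lt_or_ge n (2 ^ (l + 1)) with h | h
    · exact ih n h s (by omega)
    · obtain ⟨m, rfl⟩ := Nat.exists_eq_add_of_le h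
      obtain ⟨i, hi⟩ := exists_le _ s hs
      have := sub_sum _ s i hi
      -- Removing `2 ^ (l + 1)` leaves degree at least `4 * 2 ^ l - 2`, more than the `3 * 2 ^ l -
      -- 2` required at level `l`.
      exact step (l + 1) m (by omega) s i hi (ih m (by omega) _ (by omega))

theorem monomial_mem_coeffIdeal [CharP K 2] {n l : ℕ} (h : n < 2 ^ (l + 1)) (s : Fin 3 →₀ ℕ)
    (hs : 3 * 2 ^ l ≤ s 0 + s 1 + s 2 + 2) (c : K) : monomial s c ∈ coeffIdeal K n := by
  obtain ⟨a, has, -, ha⟩ := exists_le_coeff_genericForm_pow_eq_monomial (K := K) l n h s hs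
  obtain ⟨b, rfl⟩ := exists_add_of_le has
  rw [← one_mul c, ← monomial_mul]
  exact Ideal.mul_mem_right _ _ (Ideal.subset_span ⟨⟨a, rfl⟩, a, ha⟩)

end CoeffIdeal

/-! ### Homogeneous components of quotients of the polynomial ring -/

section Grading

variable {K : Type*} [Field K]

theorem weight_one_int (s : Fin 3 →₀ ℕ) :
    Finsupp.weight (fun _ => (1 : ℤ)) s = ((s 0 + s 1 + s 2 : ℕ) : ℤ) := by
  rw [Finsupp.weight_apply, Finsupp.sum_fintype _ _ (by simp), Fin.sum_univ_three]
  simp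

theorem quotientGrading_eq_bot {I : Ideal (MvPolynomial (Fin 3) K)} {j : ℤ}
    (h : ∀ s : Fin 3 →₀ ℕ, ((s 0 + s 1 + s 2 : ℕ) : ℤ) = j → ∀ c : K, monomial s c ∈ I) :
    quotientGrading I j = ⊥ := by
  rw [quotientGrading, eq_bot_iff, Submodule.map_le_iff_le_comap]
  intro p hp
  refine Ideal.Quotient.eq_zero_iff_mem.mpr ?_
  rw [p.as_sum]
  refine Ideal.sum_mem _ fun s hs => h s ?_ _
  rw [← weight_one_int]
  exact (mem_weightedHomogeneousSubmodule K _ _ _).mp hp (mem_support_iff.mp hs)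

theorem quotientGrading_ne_bot {I : Ideal (MvPolynomial (Fin 3) K)} {s : Fin 3 →₀ ℕ}
    (h : monomial s (1 : K) ∉ I) :
    quotientGrading I ((s 0 + s 1 + s 2 : ℕ) : ℤ) ≠ ⊥ := by
  rw [Submodule.ne_bot_iff]
  refine ⟨_, Submodule.mem_map_of_mem (p := weightedHomogeneousSubmodule K _ _)
    (r := monomial s (1 : K)) ?_, fun h0 => h ?_⟩
  · rw [mem_weightedHomogeneousSubmodule, ← weight_one_int]
    exact isWeightedHomogeneous_monomial _ s _ rfl
  · exact Ideal.Quotient.eq_zero_iff_mem.mp h0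

end Grading

/-! ### Regularity from Koszul homology -/

section Regularity

variable {K M : Type*} [Field K] [AddCommGroup M] [Module K M]
  [Module (MvPolynomial (Fin 3) K) M] [IsScalarTower K (MvPolynomial (Fin 3) K) M]
  (𝓜 : ℤ → Submodule K M)

/-- The `i`-th Koszul homology in degree `j` vanishes when the component of degree `j - i` does. -/
theorem subsingleton_gradedTor_of_eq_bot {i : ℕ} {j : ℤ} (h : 𝓜 (j - i) = ⊥) :
    Subsingleton ((Koszul.resolution K).gradedTor 𝓜 i j) := by
  have : Subsingleton ((Koszul.resolution K).homogeneousCycles 𝓜 i j) := by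
    rw [Submodule.subsingleton_iff_eq_bot, eq_bot_iff]
    rintro x ⟨-, hx⟩
    refine (Submodule.mem_bot K).mpr (funext fun b => ?_)
    have hb : x b ∈ 𝓜 (j - i) := hx b (Set.mem_univ b)
    rwa [h, Submodule.mem_bot] at hb
  exact (Submodule.Quotient.mk_surjective _).subsingleton

/-- In the top degree of `M`, every element is a Koszul cycle of homological degree `3`. -/
theorem nontrivial_gradedTor_three {D : ℤ} (h : 𝓜 D ≠ ⊥)
    (hM : ∀ x ∈ 𝓜 D, ∀ k, (X k : MvPolynomial (Fin 3) K) • x = 0) :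
    Nontrivial ((Koszul.resolution K).gradedTor 𝓜 3 (D + 3)) := by
  obtain ⟨x, hx, hx0⟩ := Submodule.exists_mem_ne_zero_of_ne_bot h
  let z : (Koszul.resolution K).ι 3 → M := fun _ => x
  have hz : z ∈ (Koszul.resolution K).homogeneousCycles 𝓜 3 (D + 3) := by
    refine ⟨LinearMap.mem_ker.mpr (funext fun a => ?_), fun b _ => ?_⟩
    · change Fin 3 at a
      change (∑ b : Fin 1, (!![X 2; -X 1; X 0] : Matrix (Fin 3) (Fin 1) _) a b •
        (LinearMap.proj b : (Fin 1 → M) →ₗ[MvPolynomial (Fin 3) K] M)) (fun _ => x) = 0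
      fin_cases a <;> simp [hM x hx]
    · change x ∈ 𝓜 (D + 3 - (3 : ℕ))
      simpa using hx
  refine nontrivial_of_ne (Submodule.Quotient.mk ⟨z, hz⟩) 0 fun h0 => hx0 ?_
  rw [Submodule.Quotient.mk_eq_zero] at h0
  obtain ⟨y, -, hy⟩ := h0
  -- The Koszul resolution has rank `0` in homological degree `4`, so there are no nonzero
  -- boundaries and `Tor_3` consists of the cycles.
  have : y = 0 := funext fun b => (b : Fin 0).elim0
  rw [this, map_zero] at hy
  exact (congrFun hy (0 : Fin 1)).symm

/-- The regularity of a graded module with top degree `D` is `D`. -/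
theorem regularity_eq_of_top_degree {D : ℤ} (h : 𝓜 D ≠ ⊥) (h' : ∀ j, D < j → 𝓜 j = ⊥)
    (hM : ∀ x ∈ 𝓜 D, ∀ k, (X k : MvPolynomial (Fin 3) K) • x ∈ 𝓜 (D + 1)) :
    regularity 𝓜 = ((D : ℝ) : EReal) := by
  apply le_antisymm
  · refine iSup_le fun i => ?_
    refine EReal.sub_le_of_le_add (iSup₂_le fun j hj => ?_)
    have hle : j - i ≤ D := by
      by_contra! hlt
      have := subsingleton_gradedTor_of_eq_bot 𝓜 (h' _ hlt)
      exact not_subsingleton _ this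
    have : (j : ℝ) ≤ (D : ℝ) + (i : ℝ) := by exact_mod_cast (by omega : j ≤ D + i)
    exact_mod_cast this
  · have key := nontrivial_gradedTor_three 𝓜 h fun x hx k => by
      have := hM x hx k
      rwa [h' _ (lt_add_one D), Submodule.mem_bot] at this
    have h3 : (((D + 3 : ℤ) : ℝ) : EReal) ≤
        gradedEnd ((Koszul.resolution K).gradedTor 𝓜 3) :=
      le_iSup₂_of_le (D + 3) key le_rfl
    refine le_trans ?_ (le_iSup (fun i : ℕ =>
      gradedEnd ((Koszul.resolution K).gradedTor 𝓜 i) - (i : EReal)) 3)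
    refine le_trans (le_of_eq ?_) (EReal.sub_le_sub h3 le_rfl)
    have : (D : ℝ) = ((D + 3 : ℤ) : ℝ) - ((3 : ℕ) : ℝ) := by push_cast; ring
    rw [this, EReal.coe_sub]
    rfl

end Regularity

theorem X_smul_mem_quotientGrading {K : Type*} [Field K] (I : Ideal (MvPolynomial (Fin 3) K))
    {j : ℤ} {x : MvPolynomial (Fin 3) K ⧸ I} (hx : x ∈ quotientGrading I j) (k : Fin 3) :
    (X k : MvPolynomial (Fin 3) K) • x ∈ quotientGrading I (j + 1) := by
  obtain ⟨p, hp, rfl⟩ := hx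
  refine ⟨X k * p, ?_, rfl⟩
  rw [add_comm]
  exact (isWeightedHomogeneous_X K (fun _ : Fin 3 => (1 : ℤ)) k).mul hp

theorem lemma5p6 (K : Type*) [Field K] [CharP K 2] (n l : ℕ) (hn : 1 ≤ n)
    (h₁ : 2 ^ l ≤ n) (h₂ : n ≤ 2 ^ (l + 1) - 1) :
    regularity (quotientGrading (coeffIdeal K n)) = (((3 * (2 ^ l - 1) : ℤ) : ℝ) : EReal) := by
  have hpos : 0 < 2 ^ l := by positivity
  have hcast : ((2 ^ l : ℕ) : ℤ) = 2 ^ l := by push_cast; rfl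
  refine regularity_eq_of_top_degree _ ?_ (fun j hj => ?_)
    fun x hx k => X_smul_mem_quotientGrading _ hx k
  -- The top degree is witnessed by `(UVW) ^ (2 ^ l - 1)`.
  · have := quotientGrading_ne_bot (monomial_two_pow_sub_one_notMem_coeffIdeal (K := K) h₁)
    simp only [Finsupp.equivFunOnFinite_symm_apply_apply] at this
    convert this using 2
    omega
  -- Exceeding `3 * (2 ^ l - 1)` means degree at least `3 * 2 ^ l - 2`, exactly the pigeonhole
  -- threshold.
  · refine quotientGrading_eq_bot fun s hs c => monomial_mem_coeffIdeal (l := l) ?_ s ?_ c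
    · have : 0 < 2 ^ (l + 1) := by positivity
      omega
    · omega
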